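/- Let $E$ be a finite-dimensional real normed space (for instance $\mathbb R^n$) with dual space $E^*$ and pairing $\langle x,p\rangle$. A *regular convex set* is a closed convex set with non-empty interior that contains no line; its interior is denoted $X^o$ and its polar is $X^\circ=\{p\in E^*\mid \langle x,p\rangle\le 1\ \forall x\in X\}$. For $\gamma\ge 0$, a *projectively self-concordant barrier with parameter $\gamma$* on a regular convex set $X$ is a $C^3$ function $f:X^o\to\mathbb R$ such that (1) $f''(x)[h,h]-(f'(x)[h])^2>0$ for all $x\in X^o$ and $h\neq 0$; (2) $f(x)\to+\infty$ whenever $x\in X^o$ tends to a point of $\partial X$; (3) $|f'''(x)[h,h,h]-6f''(x)[h,h]f'(x)[h]+4(f'(x)[h])^3|\le 2\gamma\,(f''(x)[h,h]-(f'(x)[h])^2)^{3/2}$ for all $x\in X^o$ and all $h$. The dual function of $f$ is $f_*(p)=-\min_{x\in X^o}\bigl(f(x)+\log(1+\langle x,p\rangle)\bigr)$; its domain of definition consists of those $p\in E^*$ such that $1+\langle x,p\rangle>0$ for all $x\in X^o$ and $x\mapsto f(x)+\log(1+\langle x,p\rangle)$ has a critical point in $X^o$. **Theorem.** Let $X\subset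 E$ be a regular convex set such that both $X$ and its polar $X^\circ$ are bounded, and let $f$ be a projectively self-concordant barrier on $X$ with parameter $\gamma$. Then the domain of definition of $f_*$ is exactly the interior of $-X^\circ$, and for every $p$ in it the minimum defining $f_*(p)$ is attained. The set $-X^\circ$ is a regular convex set in $E^*$, and $f_*$ is a projectively self-concordant barrier on $-X^\circ$ with the same parameter $\gamma$. Moreover, $1+\langle f'(x),x\rangle>0$ for all $x\in X^o$, and the map $x\mapsto p=-\dfrac{f'(x)}{1+\langle f'(x),x\rangle}$ is a bijection between the interiors of $X$ and $-X^\circ$. -/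

import Mathlib

open Filter Topology
open scoped Pointwise

namespace ProjSC

variable {E : Type*} [NormedAddCommGroup E] [NormedSpace ℝ E]

/-- A regular convex set: a closed convex set with non-empty interior, containing no
(affine) lines. -/
structure IsRegularConvexSet (X : Set E) : Prop where
  isClosed : IsClosed X
  convex : Convex ℝ X
  nonempty_interior : (interior X).Nonempty
  no_lines : ¬ ∃ x v : E, v ≠ 0 ∧ ∀ t : ℝ, x + t • v ∈ X

/-- The quadratic form `h ↦ f''(x)[h,h] - (f'(x)[h])²` of the affine metric of `f`. -/
noncomputable def affineMetric (f : E → ℝ) (x h : E) : ℝ :=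
  iteratedFDeriv ℝ 2 f x (fun _ => h) - (fderiv ℝ f x h) ^ 2

/-- The cubic form `h ↦ f'''(x)[h,h,h] - 6 f''(x)[h,h] f'(x)[h] + 4 (f'(x)[h])³` of `f`. -/
noncomputable def cubicForm (f : E → ℝ) (x h : E) : ℝ :=
  iteratedFDeriv ℝ 3 f x (fun _ => h)
    - 6 * iteratedFDeriv ℝ 2 f x (fun _ => h) * fderiv ℝ f x h
    + 4 * (fderiv ℝ f x h) ^ 3

/-- `f` is a projectively self-concordant barrier with parameter `γ ≥ 0` on the regular convex
set `X`. Only the values of `f` on the interior of `X` matter. -/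
structure IsProjSCBarrier (X : Set E) (γ : ℝ) (f : E → ℝ) : Prop where
  regular : IsRegularConvexSet X
  parameter_nonneg : 0 ≤ γ
  contDiffOn : ContDiffOn ℝ 3 f (interior X)
  affineMetric_pos : ∀ x ∈ interior X, ∀ h : E, h ≠ 0 → 0 < affineMetric f x h
  tendsto_boundary : ∀ x₀ ∈ frontier X, Tendsto f (𝓝[interior X] x₀) atTop
  cubicForm_le : ∀ x ∈ interior X, ∀ h : E,
    |cubicForm f x h| ≤ 2 * γ * (affineMetric f x h) ^ (3 / 2 : ℝ)

/-- The (one-sided) polar `X° = {p | ⟨x,p⟩ ≤ 1 for all x ∈ X}`, a subset of the dual space. -/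
def polarSet (X : Set E) : Set (StrongDual ℝ E) :=
  {p | ∀ x ∈ X, p x ≤ 1}

/-- The function `q_p(x) = f(x) + log (1 + ⟨x,p⟩)`. -/
noncomputable def dualObjective (f : E → ℝ) (p : StrongDual ℝ E) (x : E) : ℝ :=
  f x + Real.log (1 + p x)

/-- The domain of definition of the dual function: those `p` for which `q_p` is defined on the
interior of `X` (the argument of the logarithm is positive there) and has a critical point in
the interior of `X`. -/
def dualDomain (X : Set E) (f : E → ℝ) : Set (StrongDual ℝ E) :=
  {p | (∀ x ∈ interior X, 0 < 1 + p x) ∧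
    ∃ x ∈ interior X, HasFDerivAt (dualObjective f p) (0 : E →L[ℝ] ℝ) x}

/-- The dual function `f_*(p) = - min_{x ∈ int X} (f(x) + log (1 + ⟨x,p⟩))`, written with an
infimum; its values have this meaning only where the minimum exists. -/
noncomputable def dualFunction (X : Set E) (f : E → ℝ) (p : StrongDual ℝ E) : ℝ :=
  - sInf (dualObjective f p '' interior X)

/-- The duality map `x ↦ - f'(x) / (1 + ⟨f'(x),x⟩)`. -/
noncomputable def dualityMap (f : E → ℝ) (x : E) : StrongDual ℝ E :=
  - ((1 + fderiv ℝ f x x)⁻¹ • fderiv ℝ f x)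

end ProjSC

namespace ProjSC

/-! ### One-dimensional estimates -/

lemma exp_neg_lt_tangent {φ φ₁ φ₂ : ℝ → ℝ}
    (h0 : ∀ t ∈ Set.Icc (0 : ℝ) 1, HasDerivAt φ (φ₁ t) t)
    (h1 : ∀ t ∈ Set.Icc (0 : ℝ) 1, HasDerivAt φ₁ (φ₂ t) t)
    (hpos : ∀ t ∈ Set.Icc (0 : ℝ) 1, 0 < φ₂ t - φ₁ t ^ 2) :
    Real.exp (-φ 1) < Real.exp (-φ 0) * (1 - φ₁ 0) := by
  have hu : ∀ t ∈ Set.Icc (0 : ℝ) 1,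
      HasDerivAt (fun t => Real.exp (-φ t)) (Real.exp (-φ t) * -φ₁ t) t :=
    fun t ht => (h0 t ht).neg.exp
  have hu1 : ∀ t ∈ Set.Icc (0 : ℝ) 1, HasDerivAt (fun t => Real.exp (-φ t) * -φ₁ t)
      (Real.exp (-φ t) * -φ₁ t * -φ₁ t + Real.exp (-φ t) * -φ₂ t) t :=
    fun t ht => (hu t ht).mul (h1 t ht).neg
  have hanti : StrictAntiOn (fun t => Real.exp (-φ t) * -φ₁ t) (Set.Icc 0 1) := by
    refine strictAntiOn_of_deriv_neg (convex_Icc 0 1)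
      (fun t ht => (hu1 t ht).continuousAt.continuousWithinAt) fun t ht => ?_
    have ht' := interior_subset ht
    rw [(hu1 t ht').deriv]
    have := mul_pos (Real.exp_pos (-φ t)) (hpos t ht')
    linarith
  obtain ⟨c, hc, hc'⟩ := exists_hasDerivAt_eq_slope _ _ zero_lt_one
    (fun t ht => (hu t ht).continuousAt.continuousWithinAt)
    (fun t ht => hu t (Set.Ioo_subset_Icc_self ht))
  have := hanti (Set.left_mem_Icc.2 zero_le_one) (Set.Ioo_subset_Icc_self hc) hc.1
  simp only [sub_zero, div_one] at hc'
  simp only [hc'] at this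
  linarith

lemma antitoneOn_Ico_of_hasDerivAt {g g' : ℝ → ℝ}
    (hg : ∀ t ∈ Set.Ico (0 : ℝ) 1, HasDerivAt g (g' t) t)
    (hg' : ∀ t ∈ Set.Ico (0 : ℝ) 1, g' t ≤ 0) : AntitoneOn g (Set.Ico 0 1) := by
  refine antitoneOn_of_deriv_nonpos (convex_Ico 0 1)
    (fun t ht => (hg t ht).continuousAt.continuousWithinAt)
    (fun t ht => (hg t (interior_subset ht)).differentiableAt.differentiableWithinAt) fun t ht => ?_
  rw [(hg t (interior_subset ht)).deriv]
  exact hg' t (interior_subset ht)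

lemma hasDerivAt_exp_div_sqrt {φ φ₁ φ₂ : ℝ → ℝ} {c t : ℝ}
    (h0 : HasDerivAt φ (φ₁ t) t) (h1 : HasDerivAt φ₁ (φ₂ t) t) (h2 : HasDerivAt φ₂ c t)
    (hpos : 0 < φ₂ t - φ₁ t ^ 2) :
    HasDerivAt (fun t => Real.exp (2 * φ t) / √(φ₂ t - φ₁ t ^ 2))
      (-(Real.exp (2 * φ t) * (c - 6 * φ₂ t * φ₁ t + 4 * φ₁ t ^ 3)) /
        (2 * (φ₂ t - φ₁ t ^ 2) ^ (3 / 2 : ℝ))) t := by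
  have hm : HasDerivAt (fun t => φ₂ t - φ₁ t ^ 2) (c - 2 * φ₁ t * φ₂ t) t := by
    refine (h2.sub (h1.pow 2)).congr_deriv ?_
    norm_num
  have hs : 0 < √(φ₂ t - φ₁ t ^ 2) := Real.sqrt_pos.2 hpos
  have hr : (φ₂ t - φ₁ t ^ 2) ^ (3 / 2 : ℝ) = √(φ₂ t - φ₁ t ^ 2) ^ 3 := by
    rw [Real.sqrt_eq_rpow, ← Real.rpow_mul_natCast hpos.le]
    norm_num
  have := ((h0.const_mul 2).exp).div (hm.sqrt hpos.ne') hs.ne'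
  refine this.congr_deriv ?_
  rw [hr]
  have hsq : √(φ₂ t - φ₁ t ^ 2) ^ 2 = φ₂ t - φ₁ t ^ 2 := Real.sq_sqrt hpos.le
  generalize √(φ₂ t - φ₁ t ^ 2) = s at *
  have h2 : φ₂ t = s ^ 2 + φ₁ t ^ 2 := by linarith
  rw [h2]
  field_simp
  ring

/-- Along a segment ending at the boundary, `exp (-φ)` has infinite slope at the end point. -/
lemma exists_exp_neg_gt {φ φ₁ φ₂ φ₃ : ℝ → ℝ} {γ : ℝ}
    (h0 : ∀ t ∈ Set.Ico (0 : ℝ) 1, HasDerivAt φ (φ₁ t) t)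
    (h1 : ∀ t ∈ Set.Ico (0 : ℝ) 1, HasDerivAt φ₁ (φ₂ t) t)
    (h2 : ∀ t ∈ Set.Ico (0 : ℝ) 1, HasDerivAt φ₂ (φ₃ t) t)
    (hpos : ∀ t ∈ Set.Ico (0 : ℝ) 1, 0 < φ₂ t - φ₁ t ^ 2)
    (hγ : 0 ≤ γ)
    (hC : ∀ t ∈ Set.Ico (0 : ℝ) 1, |φ₃ t - 6 * φ₂ t * φ₁ t + 4 * φ₁ t ^ 3| ≤
      2 * γ * (φ₂ t - φ₁ t ^ 2) ^ (3 / 2 : ℝ))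
    (htan : ∀ t ∈ Set.Ico (0 : ℝ) 1, φ₁ t * (1 - t) ≤ 1) (M : ℝ) :
    ∃ t ∈ Set.Ico (0 : ℝ) 1, M * (1 - t) < Real.exp (-φ t) := by
  by_contra! hcon
  have h00 : (0 : ℝ) ∈ Set.Ico (0 : ℝ) 1 := by simp
  have h1t : ∀ t ∈ Set.Ico (0 : ℝ) 1, 0 < 1 - t := fun t ht => by linarith [ht.2]
  have hM : 0 < M := by
    have := hcon 0 h00
    have := Real.exp_pos (-φ 0)
    linarith
  set u : ℝ → ℝ := fun t => Real.exp (-φ t) with hu_def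
  have hupos : ∀ t, 0 < u t := fun t => Real.exp_pos _
  have hu : ∀ t ∈ Set.Ico (0 : ℝ) 1, HasDerivAt u (u t * -φ₁ t) t :=
    fun t ht => (h0 t ht).neg.exp
  have hu1 : ∀ t ∈ Set.Ico (0 : ℝ) 1, HasDerivAt (fun t => u t * -φ₁ t)
      (u t * -φ₁ t * -φ₁ t + u t * -φ₂ t) t :=
    fun t ht => (hu t ht).mul (h1 t ht).neg
  have hsub : ∀ t : ℝ, HasDerivAt (fun t : ℝ => 1 - t) (-1) t := fun t => by
    simpa using (hasDerivAt_id t).const_sub 1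
  -- lower bound for `u`
  obtain ⟨c, hc, hlow⟩ : ∃ c : ℝ, 0 < c ∧ ∀ t ∈ Set.Ico (0 : ℝ) 1, c * (1 - t) ≤ u t := by
    refine ⟨u 0, hupos 0, fun t ht => ?_⟩
    have := antitoneOn_Ico_of_hasDerivAt (g := fun t => -(u t / (1 - t)))
      (fun t ht => ((hu t ht).div (hsub t) (h1t t ht).ne').neg) (fun t ht => by
        have h := mul_le_mul_of_nonneg_left (htan t ht) (hupos t).le
        have : 0 ≤ (u t * -φ₁ t * (1 - t) - u t * -1) / (1 - t) ^ 2 :=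
          div_nonneg (by linarith) (sq_nonneg _)
        linarith) h00 ht ht.1
    simp only [sub_zero, div_one, neg_le_neg_iff] at this
    rwa [le_div_iff₀ (h1t t ht)] at this
  -- the growth of `exp (2 φ) / √m`
  obtain ⟨A, hA, hR⟩ : ∃ A : ℝ, 0 < A ∧ ∀ t ∈ Set.Ico (0 : ℝ) 1,
      Real.exp (2 * φ t) / √(φ₂ t - φ₁ t ^ 2) ≤ A / (1 - t) := by
    set R : ℝ → ℝ := fun t => Real.exp (2 * φ t) / √(φ₂ t - φ₁ t ^ 2) with hRdef
    have hRpos : 0 < R 0 := div_pos (Real.exp_pos _) (Real.sqrt_pos.2 (hpos 0 h00))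
    refine ⟨R 0 + γ / c ^ 2, by positivity, fun t ht => ?_⟩
    have hinv : ∀ t ∈ Set.Ico (0 : ℝ) 1,
        HasDerivAt (fun t : ℝ => γ / c ^ 2 * (1 - t)⁻¹) (γ / c ^ 2 * (1 / (1 - t) ^ 2)) t := by
      intro t ht
      simpa using ((hsub t).inv (h1t t ht).ne').const_mul (γ / c ^ 2)
    have := antitoneOn_Ico_of_hasDerivAt (fun t ht =>
      (hasDerivAt_exp_div_sqrt (h0 t ht) (h1 t ht) (h2 t ht) (hpos t ht)).sub (hinv t ht))
      (fun t ht => by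
        have hm : 0 < (φ₂ t - φ₁ t ^ 2) ^ (3 / 2 : ℝ) := Real.rpow_pos_of_pos (hpos t ht) _
        have hs := h1t t ht
        have hl := hlow t ht
        have e1 : Real.exp (2 * φ t) = 1 / u t ^ 2 := by
          rw [hu_def, ← Real.exp_nat_mul, one_div, ← Real.exp_neg]
          congr 1; push_cast; ring
        have e3 : -(Real.exp (2 * φ t) * (φ₃ t - 6 * φ₂ t * φ₁ t + 4 * φ₁ t ^ 3)) /
            (2 * (φ₂ t - φ₁ t ^ 2) ^ (3 / 2 : ℝ)) ≤ γ * Real.exp (2 * φ t) := by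
          rw [div_le_iff₀ (by positivity)]
          have := mul_le_mul_of_nonneg_left ((neg_le_abs _).trans (hC t ht))
            (Real.exp_pos (2 * φ t)).le
          linarith
        have e4 : Real.exp (2 * φ t) ≤ 1 / (c * (1 - t)) ^ 2 := by
          rw [e1]
          exact one_div_le_one_div_of_le (by positivity)
            (pow_le_pow_left₀ (by positivity) hl 2)
        have e5 := mul_le_mul_of_nonneg_left e4 hγ
        have e6 : γ * (1 / (c * (1 - t)) ^ 2) = γ / c ^ 2 * (1 / (1 - t) ^ 2) := by
          field_simp
        linarith) h00 ht ht.1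
    simp only [Pi.sub_apply, sub_zero, inv_one, mul_one] at this
    have hs := h1t t ht
    have h3 : R 0 ≤ R 0 / (1 - t) := by
      rw [le_div_iff₀ hs]
      nlinarith [ht.1]
    have h4 : γ / c ^ 2 ≥ 0 := by positivity
    rw [add_div, div_eq_mul_inv (γ / c ^ 2)]
    change R t - _ ≤ R 0 - _ at this
    linarith
  -- the second derivative of `u`
  obtain ⟨k, hk, hq⟩ : ∃ k : ℝ, 0 < k ∧ ∀ t ∈ Set.Ico (0 : ℝ) 1,
      k / (1 - t) ≤ u t * (φ₂ t - φ₁ t ^ 2) := by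
    refine ⟨1 / (A ^ 2 * M ^ 3), by positivity, fun t ht => ?_⟩
    have hs := h1t t ht
    have hu0 := hupos t
    have hm := hpos t ht
    have hsm : 0 < √(φ₂ t - φ₁ t ^ 2) := Real.sqrt_pos.2 hm
    have hsq : √(φ₂ t - φ₁ t ^ 2) ^ 2 = φ₂ t - φ₁ t ^ 2 := Real.sq_sqrt hm.le
    have e1 : Real.exp (2 * φ t) = 1 / u t ^ 2 := by
      rw [hu_def, ← Real.exp_nat_mul, one_div, ← Real.exp_neg]
      congr 1; push_cast; ring
    have hR' := hR t ht
    rw [e1, div_div, div_le_div_iff₀ (by positivity) hs, one_mul] at hR'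
    have hR2 := pow_le_pow_left₀ hs.le hR' 2
    have hub : u t ^ 3 ≤ (M * (1 - t)) ^ 3 := pow_le_pow_left₀ hu0.le (hcon t ht) 3
    rw [div_div, div_le_iff₀ (by positivity)]
    rw [mul_pow, mul_pow, hsq] at hR2
    have h5 : A ^ 2 * (u t * (φ₂ t - φ₁ t ^ 2)) * u t ^ 3 ≤
        A ^ 2 * (u t * (φ₂ t - φ₁ t ^ 2)) * (M * (1 - t)) ^ 3 :=
      mul_le_mul_of_nonneg_left hub (by positivity)
    have h6 : (1 - t) ^ 2 * 1 ≤ (1 - t) ^ 2 *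
        (u t * (φ₂ t - φ₁ t ^ 2) * (A ^ 2 * M ^ 3 * (1 - t))) := by nlinarith
    exact le_of_mul_le_mul_left h6 (by positivity)
  have hlog : ∀ t ∈ Set.Ico (0 : ℝ) 1,
      HasDerivAt (fun t : ℝ => k * Real.log (1 - t)) (k * (-1 / (1 - t))) t :=
    fun t ht => ((hsub t).log (h1t t ht).ne').const_mul k
  have hmono : AntitoneOn ((fun t => u t * -φ₁ t) - fun t : ℝ => k * Real.log (1 - t))
      (Set.Ico 0 1) :=
    antitoneOn_Ico_of_hasDerivAt (fun t ht => (hu1 t ht).sub (hlog t ht)) (fun t ht => by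
      have := hq t ht
      have e : k * (-1 / (1 - t)) = - (k / (1 - t)) := by ring
      rw [e]
      linarith)
  have hlb : ∀ t ∈ Set.Ico (0 : ℝ) 1, -M ≤ u t * -φ₁ t := fun t ht => by
    have hs := h1t t ht
    have h := mul_le_mul_of_nonneg_left (htan t ht) (hupos t).le
    have h' := hcon t ht
    have : u t * φ₁ t * (1 - t) ≤ M * (1 - t) := by
      change u t ≤ _ at h'
      linarith
    have := le_of_mul_le_mul_right this hs
    linarith
  set B := (|u 0 * -φ₁ 0| + M + 1) / k with hB
  have hBpos : 0 < B := by positivity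
  have hT : 1 - Real.exp (-B) ∈ Set.Ico (0 : ℝ) 1 := by
    have := Real.exp_pos (-B)
    have : Real.exp (-B) ≤ 1 := Real.exp_le_one_iff.2 (by linarith)
    constructor <;> linarith
  have h7 := hmono h00 hT hT.1
  have h8 := hlb _ hT
  simp only [Pi.sub_apply, sub_zero, Real.log_one, mul_zero, sub_sub_cancel, Real.log_exp] at h7
  have h9 : k * B = |u 0 * -φ₁ 0| + M + 1 := by rw [hB]; field_simp
  have h10 := le_abs_self (u 0 * -φ₁ 0)
  linarith

end ProjSC

namespace ProjSC

/-! ### Derivatives along curves -/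

section Curve

variable {V : Type*} [NormedAddCommGroup V] [NormedSpace ℝ V]

lemma iteratedFDeriv_three_apply (F : V → ℝ) (y h : V) :
    iteratedFDeriv ℝ 3 F y (fun _ => h) = fderiv ℝ (fderiv ℝ (fderiv ℝ F)) y h h h := by
  rw [iteratedFDeriv_succ_apply_right, iteratedFDeriv_two_apply]
  rfl

lemma affineMetric_eq (F : V → ℝ) (y h : V) :
    affineMetric F y h = fderiv ℝ (fderiv ℝ F) y h h - (fderiv ℝ F y h) ^ 2 := by
  rw [affineMetric, iteratedFDeriv_two_apply]

lemma cubicForm_eq (F : V → ℝ) (y h : V) :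
    cubicForm F y h = fderiv ℝ (fderiv ℝ (fderiv ℝ F)) y h h h
      - 6 * fderiv ℝ (fderiv ℝ F) y h h * fderiv ℝ F y h + 4 * (fderiv ℝ F y h) ^ 3 := by
  rw [cubicForm, iteratedFDeriv_three_apply, iteratedFDeriv_two_apply]

lemma _root_.ContDiffAt.hasFDerivAt_fderiv {F : V → ℝ} {y : V} (hF : ContDiffAt ℝ 3 F y) :
    HasFDerivAt (fderiv ℝ F) (fderiv ℝ (fderiv ℝ F) y) y :=
  ((hF.fderiv_right (m := 2) (by norm_num)).differentiableAt (by norm_num)).hasFDerivAt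

lemma _root_.ContDiffAt.hasFDerivAt_fderiv_fderiv {F : V → ℝ} {y : V} (hF : ContDiffAt ℝ 3 F y) :
    HasFDerivAt (fderiv ℝ (fderiv ℝ F)) (fderiv ℝ (fderiv ℝ (fderiv ℝ F)) y) y :=
  (((hF.fderiv_right (m := 2) (by norm_num)).fderiv_right (m := 1)
    (by norm_num)).differentiableAt (by norm_num)).hasFDerivAt

lemma _root_.ContDiffAt.hasFDerivAt_fderiv_zero {F : V → ℝ} {y : V} (hF : ContDiffAt ℝ 3 F y) :
    HasFDerivAt F (fderiv ℝ F y) y :=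
  (hF.differentiableAt (by norm_num)).hasFDerivAt

lemma eq_zero_of_hasDerivAt_smul_add_smul_add {W : Type*} [NormedAddCommGroup W]
    [NormedSpace ℝ W] {a b : ℝ → ℝ} {A B C : ℝ → W} {a' b' t : ℝ} {A' B' C' : W}
    (ha : HasDerivAt a a' t) (hA : HasDerivAt A A' t) (hb : HasDerivAt b b' t)
    (hB : HasDerivAt B B' t) (hC : HasDerivAt C C' t)
    (h : ∀ᶠ s in 𝓝 t, a s • A s + b s • B s + C s = 0) :
    a t • A' + a' • A t + (b t • B' + b' • B t) + C' = 0 :=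
  (((ha.smul hA).add (hb.smul hB)).add hC).unique
    ((hasDerivAt_const t (0 : W)).congr_of_eventuallyEq h)

lemma hasDerivAt_comp_of_hasFDerivAt {W : Type*} [NormedAddCommGroup W] [NormedSpace ℝ W]
    {G : V → W} {G' : V →L[ℝ] W} {y : ℝ → V} {y₁ : V} {t : ℝ}
    (hG : HasFDerivAt G G' (y t)) (hy : HasDerivAt y y₁ t) :
    HasDerivAt (fun s => G (y s)) (G' y₁) t :=
  hG.comp_hasDerivAt t hy

/-- First derivative of the identity `(1 + ⟨y, w⟩) F'(y) = -w` along a curve. -/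
lemma fderiv_fderiv_curve {F : V → ℝ} {y : ℝ → V} {y₁ : V}
    {w : ℝ → StrongDual ℝ V} {w₁ : StrongDual ℝ V} {t : ℝ}
    (hF : ContDiffAt ℝ 3 F (y t))
    (hy : HasDerivAt y y₁ t) (hw : HasDerivAt w w₁ t)
    (heq : ∀ᶠ s in 𝓝 t, (1 + w s (y s)) • fderiv ℝ F (y s) + w s = 0) :
    (1 + w t (y t)) • fderiv ℝ (fderiv ℝ F) (y t) y₁ + (w₁ (y t) + w t y₁) • fderiv ℝ F (y t)
      + w₁ = 0 := by
  have hD : HasDerivAt (fun s => 1 + w s (y s)) (w₁ (y t) + w t y₁) t :=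
    (hw.clm_apply hy).const_add 1
  have h := (hD.smul (hF.hasFDerivAt_fderiv.comp_hasDerivAt t hy)).add hw
  exact h.unique ((hasDerivAt_const t (0 : StrongDual ℝ V)).congr_of_eventuallyEq heq)

/-- Second derivative of the identity `(1 + ⟨y, w⟩) F'(y) = -w` along a curve. -/
lemma fderiv_fderiv_fderiv_curve {F : V → ℝ} {y y₁ : ℝ → V} {y₂ : V}
    {w w₁ : ℝ → StrongDual ℝ V} {w₂ : StrongDual ℝ V} {t : ℝ}
    (hF : ContDiffAt ℝ 3 F (y t))
    (hy : ∀ᶠ s in 𝓝 t, HasDerivAt y (y₁ s) s) (hy₁ : HasDerivAt y₁ y₂ t)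
    (hw : ∀ᶠ s in 𝓝 t, HasDerivAt w (w₁ s) s) (hw₁ : HasDerivAt w₁ w₂ t)
    (heq : ∀ᶠ s in 𝓝 t, (1 + w s (y s)) • fderiv ℝ F (y s) + w s = 0) :
    (1 + w t (y t)) • (fderiv ℝ (fderiv ℝ (fderiv ℝ F)) (y t) (y₁ t) (y₁ t)
          + fderiv ℝ (fderiv ℝ F) (y t) y₂)
      + (2 * (w₁ t (y t) + w t (y₁ t))) • fderiv ℝ (fderiv ℝ F) (y t) (y₁ t)
      + (w₂ (y t) + 2 * w₁ t (y₁ t) + w t y₂) • fderiv ℝ F (y t) + w₂ = 0 := by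
  have hyt := hy.self_of_nhds
  have hwt := hw.self_of_nhds
  have hFe : ∀ᶠ s in 𝓝 t, ContDiffAt ℝ 3 F (y s) :=
    hyt.continuousAt.eventually (hF.eventually (by simp))
  have hev : ∀ᶠ s in 𝓝 t, (1 + w s (y s)) • fderiv ℝ (fderiv ℝ F) (y s) (y₁ s)
      + (w₁ s (y s) + w s (y₁ s)) • fderiv ℝ F (y s) + w₁ s = 0 := by
    filter_upwards [hFe, hy, hw, heq.eventually_nhds] with s h1 h2 h3 h4
    exact fderiv_fderiv_curve h1 h2 h3 h4
  have hD : HasDerivAt (fun s => 1 + w s (y s)) (w₁ t (y t) + w t (y₁ t)) t :=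
    (hwt.clm_apply hyt).const_add 1
  have hD₁ : HasDerivAt (fun s => w₁ s (y s) + w s (y₁ s))
      ((w₂ (y t) + w₁ t (y₁ t)) + (w₁ t (y₁ t) + w t y₂)) t :=
    (hw₁.clm_apply hyt).add (hwt.clm_apply hy₁)
  have hG : HasDerivAt (fun s => fderiv ℝ F (y s)) (fderiv ℝ (fderiv ℝ F) (y t) (y₁ t)) t :=
    hF.hasFDerivAt_fderiv.comp_hasDerivAt t hyt
  have hG₂ : HasDerivAt (fun s => fderiv ℝ (fderiv ℝ F) (y s))
      (fderiv ℝ (fderiv ℝ (fderiv ℝ F)) (y t) (y₁ t)) t :=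
    hasDerivAt_comp_of_hasFDerivAt (W := V →L[ℝ] StrongDual ℝ V) hF.hasFDerivAt_fderiv_fderiv hyt
  have hG₁ : HasDerivAt (fun s => fderiv ℝ (fderiv ℝ F) (y s) (y₁ s))
      (fderiv ℝ (fderiv ℝ (fderiv ℝ F)) (y t) (y₁ t) (y₁ t)
        + fderiv ℝ (fderiv ℝ F) (y t) y₂) t :=
    hG₂.clm_apply hy₁
  have h := eq_zero_of_hasDerivAt_smul_add_smul_add hD hG₁ hD₁ hG hw₁ hev
  rw [← h]
  module

/-- The affine metric expressed through a curve satisfying `(1 + ⟨y, w⟩) F'(y) = -w`. -/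
lemma affineMetric_curve {F : V → ℝ} {y : ℝ → V} {y₁ : V}
    {w : ℝ → StrongDual ℝ V} {w₁ : StrongDual ℝ V} {t : ℝ}
    (hF : ContDiffAt ℝ 3 F (y t))
    (hy : HasDerivAt y y₁ t) (hw : HasDerivAt w w₁ t)
    (heq : ∀ᶠ s in 𝓝 t, (1 + w s (y s)) • fderiv ℝ F (y s) + w s = 0)
    (hD : 1 + w t (y t) ≠ 0) :
    affineMetric F (y t) y₁ =
      -(w₁ y₁) / (1 + w t (y t)) + w₁ (y t) * w t y₁ / (1 + w t (y t)) ^ 2 := by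
  have h1 := DFunLike.congr_fun (fderiv_fderiv_curve hF hy hw heq) y₁
  have h0 := DFunLike.congr_fun heq.self_of_nhds y₁
  simp only [add_apply, smul_apply, smul_eq_mul, zero_apply] at h0 h1
  rw [affineMetric_eq]
  generalize fderiv ℝ F (y t) y₁ = a at *
  generalize fderiv ℝ (fderiv ℝ F) (y t) y₁ y₁ = b at *
  generalize 1 + w t (y t) = D at *
  have ha : a = -(w t y₁) / D := by field_simp; linarith
  have hb : b = -((w₁ (y t) + w t y₁) * a + w₁ y₁) / D := by field_simp; linarith
  rw [hb, ha]
  field_simp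
  ring

/-- The cubic form expressed through a curve satisfying `(1 + ⟨y, w⟩) F'(y) = -w`. -/
lemma cubicForm_curve {F : V → ℝ} {y y₁ : ℝ → V} {y₂ : V}
    {w w₁ : ℝ → StrongDual ℝ V} {w₂ : StrongDual ℝ V} {t : ℝ}
    (hF : ContDiffAt ℝ 3 F (y t))
    (hy : ∀ᶠ s in 𝓝 t, HasDerivAt y (y₁ s) s) (hy₁ : HasDerivAt y₁ y₂ t)
    (hw : ∀ᶠ s in 𝓝 t, HasDerivAt w (w₁ s) s) (hw₁ : HasDerivAt w₁ w₂ t)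
    (heq : ∀ᶠ s in 𝓝 t, (1 + w s (y s)) • fderiv ℝ F (y s) + w s = 0)
    (hD : 1 + w t (y t) ≠ 0) :
    cubicForm F (y t) (y₁ t) =
      (w₁ t y₂ - w₂ (y₁ t)) / (1 + w t (y t))
      + (w₂ (y t) * w t (y₁ t) - w₁ t (y t) * w t y₂
          + 2 * w₁ t (y₁ t) * (w₁ t (y t) - w t (y₁ t))) / (1 + w t (y t)) ^ 2
      + 2 * w t (y₁ t) * w₁ t (y t) * (w t (y₁ t) - w₁ t (y t)) / (1 + w t (y t)) ^ 3 := by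
  have hsymm := (hF.isSymmSndFDerivAt (by simp; norm_num)) (y₁ t) y₂
  have e1 := fderiv_fderiv_curve hF hy.self_of_nhds hw.self_of_nhds heq
  have h1 := DFunLike.congr_fun e1 (y₁ t)
  have h1' := DFunLike.congr_fun e1 y₂
  have h0 := DFunLike.congr_fun heq.self_of_nhds (y₁ t)
  have h0' := DFunLike.congr_fun heq.self_of_nhds y₂
  have h2 := DFunLike.congr_fun (fderiv_fderiv_fderiv_curve hF hy hy₁ hw hw₁ heq) (y₁ t)
  simp only [add_apply, smul_apply, smul_eq_mul, zero_apply] at h0 h0' h1 h1' h2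
  rw [cubicForm_eq]
  rw [← hsymm] at h2
  generalize fderiv ℝ F (y t) (y₁ t) = a at *
  generalize fderiv ℝ F (y t) y₂ = a' at *
  generalize fderiv ℝ (fderiv ℝ F) (y t) (y₁ t) (y₁ t) = b at *
  generalize fderiv ℝ (fderiv ℝ F) (y t) (y₁ t) y₂ = b' at *
  generalize fderiv ℝ (fderiv ℝ (fderiv ℝ F)) (y t) (y₁ t) (y₁ t) (y₁ t) = c at *
  generalize 1 + w t (y t) = D at *
  have ha : a = -(w t (y₁ t)) / D := by field_simp; linarith
  have ha' : a' = -(w t y₂) / D := by field_simp; linarith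
  have hb : b = -((w₁ t (y t) + w t (y₁ t)) * a + w₁ t (y₁ t)) / D := by field_simp; linarith
  have hb' : b' = -((w₁ t (y t) + w t (y₁ t)) * a' + w₁ t y₂) / D := by field_simp; linarith
  have hc : c = -(D * b' + 2 * (w₁ t (y t) + w t (y₁ t)) * b
      + (w₂ (y t) + 2 * w₁ t (y₁ t) + w t y₂) * a + w₂ (y₁ t)) / D := by field_simp; linarith
  rw [hc, hb', hb, ha', ha]
  field_simp
  ring

end Curve

end ProjSC

namespace ProjSC

/-! ### The polar set -/

section Polar

variable {E : Type*} [NormedAddCommGroup E] [NormedSpace ℝ E] {X : Set E}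

lemma mem_neg_polarSet {p : StrongDual ℝ E} : p ∈ -polarSet X ↔ ∀ x ∈ X, 0 ≤ 1 + p x := by
  simp only [Set.mem_neg, polarSet, Set.mem_ofPred_eq, neg_apply]
  exact forall₂_congr fun x _ => by constructor <;> intro h <;> linarith

lemma isClosed_neg_polarSet : IsClosed (-polarSet X) := by
  have : -polarSet X = ⋂ x ∈ X, {p : StrongDual ℝ E | 0 ≤ 1 + p x} := by
    ext p
    rw [mem_neg_polarSet]
    simp
  rw [this]
  exact isClosed_biInter fun x _ => isClosed_le continuous_const (by fun_prop)

lemma convex_neg_polarSet : Convex ℝ (-polarSet X) := by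
  intro p hp q hq a b ha hb hab
  rw [mem_neg_polarSet] at *
  intro x hx
  have h1 := mul_nonneg ha (hp x hx)
  have h2 := mul_nonneg hb (hq x hx)
  simp only [add_apply, smul_apply, smul_eq_mul]
  nlinarith

lemma mem_interior_neg_polarSet [FiniteDimensional ℝ E] (hc : IsClosed X)
    (hX : Bornology.IsBounded X) {p : StrongDual ℝ E} :
    p ∈ interior (-polarSet X) ↔ ∀ x ∈ X, 0 < 1 + p x := by
  constructor
  · intro hp x hx
    have hcont : Tendsto (fun s : ℝ => s • p) (𝓝 1) (𝓝 p) := by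
      have : Continuous fun s : ℝ => s • p := by fun_prop
      simpa using this.tendsto 1
    have hev := hcont.eventually (mem_interior_iff_mem_nhds.1 hp)
    obtain ⟨s, hs, hs1⟩ := ((hev.filter_mono nhdsWithin_le_nhds).and
      (self_mem_nhdsWithin (s := Set.Ioi (1 : ℝ)))).exists
    have h := (mem_neg_polarSet (p := s • p)).1 hs x hx
    simp only [smul_apply, smul_eq_mul] at h
    replace hs1 : 1 < s := hs1
    by_contra! hcon
    nlinarith
  · intro hp
    have hK : IsCompact X := Metric.isCompact_of_isClosed_isBounded hc hX
    rcases X.eq_empty_or_nonempty with rfl | hne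
    · have : (-polarSet (∅ : Set E)) = Set.univ := by
        ext q; rw [mem_neg_polarSet]; simp
      simp [this]
    obtain ⟨x₀, hx₀, hmin⟩ := hK.exists_isMinOn hne
      (f := fun x => 1 + p x) (by fun_prop)
    obtain ⟨R, hR⟩ := hX.exists_norm_le
    have hRn : 0 ≤ R := (norm_nonneg _).trans (hR x₀ hx₀)
    have hδ := hp x₀ hx₀
    refine mem_interior_iff_mem_nhds.2 (Metric.mem_nhds_iff.2
      ⟨(1 + p x₀) / (R + 1), by positivity, fun q hq => mem_neg_polarSet.2 fun x hx => ?_⟩)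
    have h1 : 1 + p x₀ ≤ 1 + p x := hmin hx
    have h2 : |(q - p) x| ≤ (1 + p x₀) / (R + 1) * R := by
      refine ((q - p).le_opNorm x).trans ?_
      have := (mem_ball_iff_norm.1 hq).le
      exact mul_le_mul this (hR x hx) (norm_nonneg _) (by positivity)
    have h3 : (1 + p x₀) / (R + 1) * R ≤ 1 + p x₀ := by
      rw [div_mul_eq_mul_div, div_le_iff₀ (by positivity)]
      nlinarith
    have h4 := neg_abs_le ((q - p) x)
    simp only [sub_apply] at h2 h4
    linarith

lemma IsRegularConvexSet.closure_interior (h : IsRegularConvexSet X) :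
    closure (interior X) = X := by
  rw [h.convex.closure_interior_eq_closure_of_nonempty_interior h.nonempty_interior,
    h.isClosed.closure_eq]

lemma IsRegularConvexSet.zero_mem_interior (h : IsRegularConvexSet X)
    (hb : Bornology.IsBounded (polarSet X)) : (0 : E) ∈ interior X := by
  by_contra h0
  obtain ⟨g, hg⟩ := geometric_hahn_banach_open_point h.convex.interior isOpen_interior h0
  rw [map_zero] at hg
  obtain ⟨x₀, hx₀⟩ := h.nonempty_interior
  have hgX : ∀ x ∈ X, g x ≤ 0 := by
    rw [← h.closure_interior]
    exact fun x hx => closure_minimal (fun y hy => (hg y hy).le)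
      (isClosed_le g.continuous continuous_const) hx
  have hmem : ∀ t : ℝ, 0 ≤ t → t • g ∈ polarSet X := fun t ht x hx => by
    have := mul_nonpos_of_nonneg_of_nonpos ht (hgX x hx)
    simp only [smul_apply, smul_eq_mul]
    linarith
  obtain ⟨R, hR⟩ := hb.exists_norm_le
  have hg0 : 0 < ‖g‖ := by
    rw [norm_pos_iff]
    rintro rfl
    simpa using hg x₀ hx₀
  have hR0 : 0 ≤ R := (norm_nonneg _).trans (hR _ (hmem 0 le_rfl))
  have := hR _ (hmem ((R + 1) / ‖g‖) (by positivity))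
  rw [norm_smul, Real.norm_of_nonneg (by positivity), div_mul_cancel₀ _ hg0.ne'] at this
  linarith

lemma isRegularConvexSet_neg_polarSet [FiniteDimensional ℝ E] (hc : IsClosed X)
    (hX : Bornology.IsBounded X) (hb : Bornology.IsBounded (polarSet X)) :
    IsRegularConvexSet (-polarSet X) where
  isClosed := isClosed_neg_polarSet
  convex := convex_neg_polarSet
  nonempty_interior := ⟨0, (mem_interior_neg_polarSet hc hX).2 (by simp)⟩
  no_lines := by
    rintro ⟨x, v, hv, h⟩
    obtain ⟨R, hR⟩ := hb.exists_norm_le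
    have hv0 : 0 < ‖v‖ := norm_pos_iff.2 hv
    have hx0 : 0 ≤ R := (norm_nonneg _).trans (hR _ (Set.mem_neg.1 (h 0)))
    have h1 := hR _ (Set.mem_neg.1 (h ((R + ‖x‖ + 1) / ‖v‖)))
    rw [norm_neg] at h1
    have h2 : ‖((R + ‖x‖ + 1) / ‖v‖) • v‖ = R + ‖x‖ + 1 := by
      rw [norm_smul, Real.norm_of_nonneg (by positivity), div_mul_cancel₀ _ hv0.ne']
    have h3 := norm_sub_le (x + ((R + ‖x‖ + 1) / ‖v‖) • v) x
    rw [add_sub_cancel_left, h2] at h3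
    linarith

end Polar

/-! ### Tangent inequalities and the duality map -/

namespace IsProjSCBarrier

variable {E : Type*} [NormedAddCommGroup E] [NormedSpace ℝ E] {X : Set E} {f : E → ℝ} {γ : ℝ}

lemma contDiffAt (hf : IsProjSCBarrier X γ f) {x : E} (hx : x ∈ interior X) :
    ContDiffAt ℝ 3 f x :=
  hf.contDiffOn.contDiffAt (isOpen_interior.mem_nhds hx)

lemma hasDerivAt_line (x v : E) (t : ℝ) : HasDerivAt (fun t : ℝ => x + t • v) v t := by
  simpa using ((hasDerivAt_id t).smul_const v).const_add x

lemma hasDerivAt_comp_line (hf : IsProjSCBarrier X γ f) {x v : E} {t : ℝ}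
    (h : x + t • v ∈ interior X) :
    HasDerivAt (fun t : ℝ => f (x + t • v)) (fderiv ℝ f (x + t • v) v) t :=
  hasDerivAt_comp_of_hasFDerivAt (hf.contDiffAt h).hasFDerivAt_fderiv_zero (hasDerivAt_line x v t)

lemma hasDerivAt_fderiv_comp_line (hf : IsProjSCBarrier X γ f) {x v : E} {t : ℝ}
    (h : x + t • v ∈ interior X) :
    HasDerivAt (fun t : ℝ => fderiv ℝ f (x + t • v) v)
      (fderiv ℝ (fderiv ℝ f) (x + t • v) v v) t := by
  have h1 : HasDerivAt (fun t : ℝ => fderiv ℝ f (x + t • v))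
      (fderiv ℝ (fderiv ℝ f) (x + t • v) v) t :=
    hasDerivAt_comp_of_hasFDerivAt (W := StrongDual ℝ E) (hf.contDiffAt h).hasFDerivAt_fderiv
      (hasDerivAt_line x v t)
  simpa using h1.clm_apply (hasDerivAt_const t v)

lemma hasDerivAt_fderiv_fderiv_comp_line (hf : IsProjSCBarrier X γ f) {x v : E} {t : ℝ}
    (h : x + t • v ∈ interior X) :
    HasDerivAt (fun t : ℝ => fderiv ℝ (fderiv ℝ f) (x + t • v) v v)
      (fderiv ℝ (fderiv ℝ (fderiv ℝ f)) (x + t • v) v v v) t := by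
  have h1 : HasDerivAt (fun t : ℝ => fderiv ℝ (fderiv ℝ f) (x + t • v))
      (fderiv ℝ (fderiv ℝ (fderiv ℝ f)) (x + t • v) v) t :=
    hasDerivAt_comp_of_hasFDerivAt (W := E →L[ℝ] StrongDual ℝ E)
      (hf.contDiffAt h).hasFDerivAt_fderiv_fderiv (hasDerivAt_line x v t)
  have h2 : HasDerivAt (fun t : ℝ => fderiv ℝ (fderiv ℝ f) (x + t • v) v)
      (fderiv ℝ (fderiv ℝ (fderiv ℝ f)) (x + t • v) v v) t := by
    simpa using h1.clm_apply (hasDerivAt_const t v)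
  simpa using h2.clm_apply (hasDerivAt_const t v)

/-- `exp (-f)` is strictly concave. -/
lemma exp_neg_lt (hf : IsProjSCBarrier X γ f) {x z : E} (hx : x ∈ interior X)
    (hz : z ∈ interior X) (hne : z ≠ x) :
    Real.exp (-f z) < Real.exp (-f x) * (1 - fderiv ℝ f x (z - x)) := by
  have hmem : ∀ t ∈ Set.Icc (0 : ℝ) 1, x + t • (z - x) ∈ interior X := fun t ht =>
    hf.regular.convex.interior.add_smul_sub_mem hx hz ht
  have := exp_neg_lt_tangent (φ := fun t : ℝ => f (x + t • (z - x)))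
    (fun t ht => hf.hasDerivAt_comp_line (hmem t ht))
    (fun t ht => hf.hasDerivAt_fderiv_comp_line (hmem t ht))
    (fun t ht => by
      have := hf.affineMetric_pos _ (hmem t ht) (z - x) (sub_ne_zero.2 hne)
      rwa [affineMetric_eq] at this)
  simpa using this

lemma fderiv_apply_sub_le (hf : IsProjSCBarrier X γ f) {x y : E} (hx : x ∈ interior X)
    (hy : y ∈ X) : fderiv ℝ f x (y - x) ≤ 1 := by
  rw [← hf.regular.closure_interior] at hy
  refine closure_minimal (t := {y | fderiv ℝ f x (y - x) ≤ 1}) (fun z hz => ?_)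
    (isClosed_le (by fun_prop) continuous_const) hy
  rcases eq_or_ne z x with rfl | hne
  · simp
  · have h1 := (Real.exp_pos (-f z)).trans (hf.exp_neg_lt hx hz hne)
    have := (pos_iff_pos_of_mul_pos h1).1 (Real.exp_pos _)
    simp only [Set.mem_ofPred_eq]
    linarith

lemma fderiv_apply_sub_lt (hf : IsProjSCBarrier X γ f) {x y : E} (hx : x ∈ interior X)
    (hy : y ∈ X) : fderiv ℝ f x (y - x) < 1 := by
  rcases eq_or_ne y x with rfl | hne
  · simp
  set v := (1 / 2 : ℝ) • (y - x) with hv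
  have hvy : y - x = (2 : ℝ) • v := by rw [hv, smul_smul]; norm_num
  have hz : x + v ∈ interior X := by
    have := hf.regular.convex.combo_interior_self_mem_interior hx hy
      (a := 1 / 2) (b := 1 / 2) (by norm_num) (by norm_num) (by norm_num)
    convert this using 1
    rw [hv]; module
  have hv0 : v ≠ 0 := by
    intro h
    rw [h, smul_zero, sub_eq_zero] at hvy
    exact hne hvy
  have h1 := hf.exp_neg_lt hx hz (by simpa using hv0)
  have h2 := hf.exp_neg_lt hz hx (by simpa [eq_comm] using hv0)
  have h3 := hf.fderiv_apply_sub_le hz hy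
  have e1 : x + v - x = v := by abel
  have e2 : x - (x + v) = -v := by abel
  have e3 : y - (x + v) = v := by
    rw [← sub_sub, hvy, two_smul]; abel
  rw [e1] at h1
  rw [e2, map_neg] at h2
  rw [e3] at h3
  rw [hvy, map_smul, smul_eq_mul]
  have hu := Real.exp_pos (-f x)
  have hu' := Real.exp_pos (-f (x + v))
  have h4 : Real.exp (-f x) * (2 * fderiv ℝ f x v) < Real.exp (-f x) * 1 := by nlinarith
  exact lt_of_mul_lt_mul_left h4 hu.le

lemma one_add_fderiv_pos (hf : IsProjSCBarrier X γ f) (h0 : (0 : E) ∈ interior X) {x : E}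
    (hx : x ∈ interior X) : 0 < 1 + fderiv ℝ f x x := by
  have := hf.fderiv_apply_sub_lt hx (interior_subset h0)
  rw [zero_sub, map_neg] at this
  linarith

end IsProjSCBarrier

section DualityMap

variable {E : Type*} [NormedAddCommGroup E] [NormedSpace ℝ E] {f : E → ℝ} {x : E}

lemma one_add_dualityMap_apply (h : 0 < 1 + fderiv ℝ f x x) (y : E) :
    1 + dualityMap f x y = (1 - fderiv ℝ f x (y - x)) / (1 + fderiv ℝ f x x) := by
  simp only [dualityMap, neg_apply, smul_apply, smul_eq_mul, map_sub]
  field_simp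
  ring

lemma one_add_dualityMap_self (h : 0 < 1 + fderiv ℝ f x x) :
    1 + dualityMap f x x = 1 / (1 + fderiv ℝ f x x) := by
  rw [one_add_dualityMap_apply h]
  simp

lemma dualityMap_eq_iff {p : StrongDual ℝ E} (h : 0 < 1 + fderiv ℝ f x x) :
    dualityMap f x = p ↔ (1 + p x) • fderiv ℝ f x + p = 0 := by
  constructor
  · rintro rfl
    rw [one_add_dualityMap_self h, dualityMap, one_div, add_neg_cancel]
  · intro hp
    have h1 := DFunLike.congr_fun hp x
    simp only [add_apply, smul_apply, smul_eq_mul, zero_apply] at h1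
    have h2 : 1 + p x = (1 + fderiv ℝ f x x)⁻¹ := by
      field_simp
      linarith
    rw [dualityMap, ← h2]
    exact (eq_neg_of_add_eq_zero_right hp).symm

lemma hasFDerivAt_dualObjective {p : StrongDual ℝ E} (hf : DifferentiableAt ℝ f x)
    (hp : 0 < 1 + p x) :
    HasFDerivAt (dualObjective f p) (fderiv ℝ f x + (1 + p x)⁻¹ • p) x := by
  have h1 : HasFDerivAt (fun x => 1 + p x) p x := p.hasFDerivAt.const_add 1
  exact hf.hasFDerivAt.add (h1.log hp.ne')

lemma hasFDerivAt_dualObjective_zero_iff {p : StrongDual ℝ E} (hf : DifferentiableAt ℝ f x)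
    (hp : 0 < 1 + p x) (h : 0 < 1 + fderiv ℝ f x x) :
    HasFDerivAt (dualObjective f p) (0 : E →L[ℝ] ℝ) x ↔ dualityMap f x = p := by
  have h1 := hasFDerivAt_dualObjective hf hp
  have e : (1 + p x) • (fderiv ℝ f x + (1 + p x)⁻¹ • p) = (1 + p x) • fderiv ℝ f x + p := by
    rw [smul_add, smul_smul, mul_inv_cancel₀ hp.ne', one_smul]
  rw [dualityMap_eq_iff h, ← e, smul_eq_zero_iff_right hp.ne']
  exact ⟨fun h' => h1.unique h', fun h' => h' ▸ h1⟩

end DualityMap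

namespace IsProjSCBarrier

variable {E : Type*} [NormedAddCommGroup E] [NormedSpace ℝ E] {X : Set E} {f : E → ℝ} {γ : ℝ}

lemma dualityMap_pos (hf : IsProjSCBarrier X γ f) (h0 : (0 : E) ∈ interior X) {x y : E}
    (hx : x ∈ interior X) (hy : y ∈ X) : 0 < 1 + dualityMap f x y := by
  have h := hf.one_add_fderiv_pos h0 hx
  rw [one_add_dualityMap_apply h]
  exact div_pos (by linarith [hf.fderiv_apply_sub_lt hx hy]) h

lemma dualObjective_lt (hf : IsProjSCBarrier X γ f) (h0 : (0 : E) ∈ interior X) {x z : E}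
    (hx : x ∈ interior X) (hz : z ∈ interior X) (hne : z ≠ x) :
    dualObjective f (dualityMap f x) x < dualObjective f (dualityMap f x) z := by
  have h := hf.one_add_fderiv_pos h0 hx
  have h1 := hf.exp_neg_lt hx hz hne
  have hpos : 0 < 1 - fderiv ℝ f x (z - x) := by
    linarith [hf.fderiv_apply_sub_lt hx (interior_subset hz)]
  have h2 := Real.log_lt_log (Real.exp_pos _) h1
  rw [Real.log_mul (Real.exp_pos _).ne' hpos.ne', Real.log_exp, Real.log_exp] at h2
  rw [dualObjective, dualObjective, one_add_dualityMap_self h, one_add_dualityMap_apply h,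
    Real.log_div hpos.ne' h.ne', Real.log_div one_ne_zero h.ne', Real.log_one]
  linarith

lemma isLeast_dualObjective (hf : IsProjSCBarrier X γ f) (h0 : (0 : E) ∈ interior X) {x : E}
    (hx : x ∈ interior X) :
    IsLeast (dualObjective f (dualityMap f x) '' interior X)
      (dualObjective f (dualityMap f x) x) := by
  refine ⟨Set.mem_image_of_mem _ hx, ?_⟩
  rintro _ ⟨z, hz, rfl⟩
  rcases eq_or_ne z x with rfl | hne
  · exact le_rfl
  · exact (hf.dualObjective_lt h0 hx hz hne).le

lemma dualFunction_dualityMap (hf : IsProjSCBarrier X γ f) (h0 : (0 : E) ∈ interior X) {x : E}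
    (hx : x ∈ interior X) :
    dualFunction X f (dualityMap f x) = -dualObjective f (dualityMap f x) x := by
  rw [dualFunction, (hf.isLeast_dualObjective h0 hx).csInf_eq]

lemma injOn_dualityMap (hf : IsProjSCBarrier X γ f) (h0 : (0 : E) ∈ interior X) :
    Set.InjOn (dualityMap f) (interior X) := by
  intro x hx z hz h
  by_contra hne
  have h1 := hf.dualObjective_lt h0 hx hz (Ne.symm hne)
  have h2 := hf.dualObjective_lt h0 hz hx hne
  rw [h] at h1
  exact lt_asymm h1 h2

variable [FiniteDimensional ℝ E]

/-- For `p` in the interior of `-X°` the objective has a critical point. -/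
lemma exists_dualityMap_eq (hf : IsProjSCBarrier X γ f) (h0 : (0 : E) ∈ interior X)
    (hX : Bornology.IsBounded X) {p : StrongDual ℝ E} (hp : ∀ x ∈ X, 0 < 1 + p x) :
    ∃ x ∈ interior X, dualityMap f x = p := by
  classical
  have hK : IsCompact X := Metric.isCompact_of_isClosed_isBounded hf.regular.isClosed hX
  set u : E → ℝ := (interior X).indicator fun x => Real.exp (-f x) with hu
  have hu_cont : ContinuousOn u X := by
    intro x hx
    by_cases hxi : x ∈ interior X
    · have h1 : ContinuousAt (fun x => Real.exp (-f x)) x :=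
        (hf.contDiffAt hxi).continuousAt.neg.rexp
      refine (h1.congr ?_).continuousWithinAt
      filter_upwards [isOpen_interior.mem_nhds hxi] with z hz
      rw [hu, Set.indicator_of_mem hz]
    · have hfr : x ∈ frontier X := ⟨subset_closure hx, hxi⟩
      have h1 : Tendsto (fun x => Real.exp (-f x)) (𝓝[interior X] x) (𝓝 0) :=
        Real.tendsto_exp_atBot.comp (tendsto_neg_atTop_atBot.comp (hf.tendsto_boundary x hfr))
      have h2 : u x = 0 := Set.indicator_of_notMem hxi _
      rw [ContinuousWithinAt, h2]
      have h3 : Tendsto u (𝓝 x) (𝓝 0) := by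
        rw [← nhdsWithin_univ, ← Set.union_compl_self (interior X), nhdsWithin_union]
        refine Tendsto.sup (h1.congr' ?_) (tendsto_const_nhds.congr' ?_)
        · filter_upwards [self_mem_nhdsWithin] with z hz
          rw [hu, Set.indicator_of_mem hz]
        · filter_upwards [self_mem_nhdsWithin] with z hz
          rw [hu, Set.indicator_of_notMem hz]
      exact h3.mono_left nhdsWithin_le_nhds
  obtain ⟨x, hx, hmax⟩ := hK.exists_isMaxOn ⟨0, interior_subset h0⟩
    (f := fun x => u x / (1 + p x))
    (hu_cont.div (by fun_prop) fun x hx => (hp x hx).ne')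
  have hux : 0 < u x / (1 + p x) := by
    refine lt_of_lt_of_le ?_ (hmax (interior_subset h0))
    have : 0 < u 0 := by rw [hu, Set.indicator_of_mem h0]; exact Real.exp_pos _
    simpa using this
  have hxi : x ∈ interior X := by
    by_contra hxi
    rw [hu, Set.indicator_of_notMem hxi, zero_div] at hux
    exact lt_irrefl _ hux
  refine ⟨x, hxi, ?_⟩
  have hd := (hf.contDiffAt hxi).differentiableAt (by norm_num)
  rw [← hasFDerivAt_dualObjective_zero_iff hd (hp x hx) (hf.one_add_fderiv_pos h0 hxi)]
  have hmin : IsLocalMin (dualObjective f p) x := by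
    filter_upwards [isOpen_interior.mem_nhds hxi] with z hz
    have h1 : u z / (1 + p z) ≤ u x / (1 + p x) := hmax (interior_subset hz)
    rw [hu, Set.indicator_of_mem hz, Set.indicator_of_mem hxi] at h1
    have h2 := hp x hx
    have h3 := hp z (interior_subset hz)
    have h4 := Real.log_le_log (div_pos (Real.exp_pos _) h3) h1
    rw [Real.log_div (Real.exp_pos _).ne' h3.ne', Real.log_div (Real.exp_pos _).ne' h2.ne',
      Real.log_exp, Real.log_exp] at h4
    rw [dualObjective, dualObjective]
    linarith
  have h1 := hasFDerivAt_dualObjective hd (hp x hx)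
  rwa [hmin.hasFDerivAt_eq_zero h1] at h1

lemma bijOn_dualityMap (hf : IsProjSCBarrier X γ f) (h0 : (0 : E) ∈ interior X)
    (hX : Bornology.IsBounded X) :
    Set.BijOn (dualityMap f) (interior X) (interior (-polarSet X)) := by
  refine ⟨fun x hx => ?_, hf.injOn_dualityMap h0, fun p hp => ?_⟩
  · exact (mem_interior_neg_polarSet hf.regular.isClosed hX).2
      fun y hy => hf.dualityMap_pos h0 hx hy
  · exact hf.exists_dualityMap_eq h0 hX ((mem_interior_neg_polarSet hf.regular.isClosed hX).1 hp)

lemma dualDomain_eq (hf : IsProjSCBarrier X γ f) (h0 : (0 : E) ∈ interior X)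
    (hX : Bornology.IsBounded X) : dualDomain X f = interior (-polarSet X) := by
  have hb := hf.bijOn_dualityMap h0 hX
  have key : ∀ {p : StrongDual ℝ E} {x : E}, x ∈ interior X → 0 < 1 + p x →
      (HasFDerivAt (dualObjective f p) (0 : E →L[ℝ] ℝ) x ↔ dualityMap f x = p) :=
    fun hx hp => hasFDerivAt_dualObjective_zero_iff
      ((hf.contDiffAt hx).differentiableAt (by norm_num)) hp (hf.one_add_fderiv_pos h0 hx)
  ext p
  constructor
  · rintro ⟨hp, x, hx, hcrit⟩
    rw [← (key hx (hp x hx)).1 hcrit]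
    exact hb.mapsTo hx
  · intro hp
    have hpos := (mem_interior_neg_polarSet hf.regular.isClosed hX).1 hp
    obtain ⟨x, hx, rfl⟩ := hb.surjOn hp
    exact ⟨fun z hz => hpos z (interior_subset hz), x, hx,
      (key hx (hpos x (interior_subset hx))).2 rfl⟩

end IsProjSCBarrier

end ProjSC

namespace ProjSC

/-- The inverse of the duality map on the interior of `X`. -/
noncomputable def dualityInv {E : Type*} [NormedAddCommGroup E] [NormedSpace ℝ E] (X : Set E)
    (f : E → ℝ) : StrongDual ℝ E → E :=
  Function.invFunOn (dualityMap f) (interior X)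

lemma finrank_strongDual (E : Type*) [NormedAddCommGroup E] [NormedSpace ℝ E]
    [FiniteDimensional ℝ E] : Module.finrank ℝ E = Module.finrank ℝ (StrongDual ℝ E) := by
  rw [← Subspace.dual_finrank_eq (K := ℝ) (V := E)]
  exact (LinearMap.toContinuousLinearMap (𝕜 := ℝ) (E := E) (F' := ℝ)).finrank_eq

lemma contDiffAt_neg_inv_smul {V E W : Type*} [NormedAddCommGroup V] [NormedSpace ℝ V]
    [NormedAddCommGroup E] [NormedSpace ℝ E] [NormedAddCommGroup W] [NormedSpace ℝ W]
    {n : WithTop ℕ∞} {a : V → ℝ} {φ : V → E} {p : V} (ha : ContDiffAt ℝ n a p) (ha0 : a p ≠ 0)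
    (hφ : ContDiffAt ℝ n φ p) (T : E →L[ℝ] W) :
    ContDiffAt ℝ n (fun q => -((a q)⁻¹ • T (φ q))) p :=
  ((ha.inv ha0).smul (T.contDiff.contDiffAt.comp p hφ)).neg

lemma smul_neg_inv_smul_add_self {W : Type*} [AddCommGroup W] [Module ℝ W] {a : ℝ} (ha : a ≠ 0)
    (w : W) : a • -(a⁻¹ • w) + w = 0 := by
  rw [smul_neg, smul_smul, mul_inv_cancel₀ ha, one_smul, neg_add_cancel]

namespace IsProjSCBarrier

variable {E : Type*} [NormedAddCommGroup E] [NormedSpace ℝ E] {X : Set E} {f : E → ℝ} {γ : ℝ}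

/-! ### Boundary behaviour -/

lemma exists_dualObjective_lt (hf : IsProjSCBarrier X γ f) (h0 : (0 : E) ∈ interior X)
    {p : StrongDual ℝ E} {y : E} (hy : y ∈ X) (hpy : 1 + p y = 0) (B : ℝ) :
    ∃ x ∈ interior X, 0 < 1 + p x ∧ dualObjective f p x < B := by
  have hmem : ∀ t ∈ Set.Ico (0 : ℝ) 1, 0 + t • y ∈ interior X := fun t ht => by
    simpa using hf.regular.convex.combo_interior_self_mem_interior h0 hy
      (a := 1 - t) (b := t) (by linarith [ht.2]) ht.1 (by ring)
  have hy0 : y ≠ 0 := by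
    rintro rfl
    simp at hpy
  obtain ⟨t, ht, hlt⟩ := exists_exp_neg_gt (φ := fun t : ℝ => f (0 + t • y))
    (fun t ht => hf.hasDerivAt_comp_line (hmem t ht))
    (fun t ht => hf.hasDerivAt_fderiv_comp_line (hmem t ht))
    (fun t ht => hf.hasDerivAt_fderiv_fderiv_comp_line (hmem t ht))
    (fun t ht => by
      have := hf.affineMetric_pos _ (hmem t ht) y hy0
      rwa [affineMetric_eq] at this)
    hf.parameter_nonneg
    (fun t ht => by
      have := hf.cubicForm_le _ (hmem t ht) y
      rwa [affineMetric_eq, cubicForm_eq] at this)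
    (fun t ht => by
      have := hf.fderiv_apply_sub_le (hmem t ht) hy
      have e : y - (0 + t • y) = (1 - t) • y := by module
      rw [e, map_smul, smul_eq_mul] at this
      linarith) (Real.exp (-B))
  have h1t : 0 < 1 - t := by linarith [ht.2]
  have e : 1 + p (0 + t • y) = 1 - t := by
    simp only [zero_add, map_smul, smul_eq_mul]
    linear_combination t * hpy
  refine ⟨0 + t • y, hmem t ht, by rwa [e], ?_⟩
  have := Real.log_lt_log (by positivity) hlt
  rw [Real.log_mul (Real.exp_pos _).ne' h1t.ne', Real.log_exp, Real.log_exp] at this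
  rw [dualObjective, e]
  linarith

/-! ### Smoothness -/

lemma tendsto_line (x v : E) : Tendsto (fun t : ℝ => x + t • v) (𝓝 0) (𝓝 x) := by
  simpa using (hasDerivAt_line x v 0).continuousAt.tendsto

lemma contDiffAt_dualityMap (hf : IsProjSCBarrier X γ f) (h0 : (0 : E) ∈ interior X) {x : E}
    (hx : x ∈ interior X) : ContDiffAt ℝ 2 (dualityMap f) x := by
  have h1 : ContDiffAt ℝ 2 (fderiv ℝ f) x := (hf.contDiffAt hx).fderiv_right (by norm_num)
  have h2 : ContDiffAt ℝ 2 (fun x => 1 + fderiv ℝ f x x) x :=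
    contDiffAt_const.add (h1.clm_apply contDiffAt_id)
  exact ((h2.inv (hf.one_add_fderiv_pos h0 hx).ne').smul h1).neg

lemma eventually_dualityMap_eq (hf : IsProjSCBarrier X γ f) (h0 : (0 : E) ∈ interior X) {x : E}
    (hx : x ∈ interior X) :
    ∀ᶠ z in 𝓝 x, (1 + dualityMap f z z) • fderiv ℝ f z + dualityMap f z = 0 := by
  filter_upwards [isOpen_interior.mem_nhds hx] with z hz
  exact (dualityMap_eq_iff (hf.one_add_fderiv_pos h0 hz)).1 rfl

lemma fderiv_dualityMap_injective (hf : IsProjSCBarrier X γ f) (h0 : (0 : E) ∈ interior X) {x : E}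
    (hx : x ∈ interior X) : Function.Injective (fderiv ℝ (dualityMap f) x) := by
  rw [injective_iff_map_eq_zero]
  intro h hh
  by_contra hne
  have hx0 : x + (0 : ℝ) • h = x := by simp
  have hline := hasDerivAt_line x h 0
  have hψ : HasDerivAt (fun t : ℝ => dualityMap f (x + t • h))
      (fderiv ℝ (dualityMap f) x h) 0 :=
    hasDerivAt_comp_of_hasFDerivAt (W := StrongDual ℝ E)
      (by rw [hx0]
          exact ((hf.contDiffAt_dualityMap h0 hx).differentiableAt (by norm_num)).hasFDerivAt)
      hline
  rw [hh] at hψ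
  have hev : ∀ᶠ t in 𝓝 (0 : ℝ), (1 + dualityMap f (x + t • h) (x + t • h)) •
      fderiv ℝ f (x + t • h) + dualityMap f (x + t • h) = 0 :=
    (tendsto_line x h).eventually (hf.eventually_dualityMap_eq h0 hx)
  have hm := affineMetric_curve (y := fun t : ℝ => x + t • h)
    (by rw [hx0]; exact hf.contDiffAt hx) hline hψ hev
    (by rw [hx0]; exact (hf.dualityMap_pos h0 hx (interior_subset hx)).ne')
  have := hf.affineMetric_pos x hx h hne
  simp at hm
  linarith

variable [FiniteDimensional ℝ E]

lemma dualityInv_mem (hf : IsProjSCBarrier X γ f) (h0 : (0 : E) ∈ interior X)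
    (hX : Bornology.IsBounded X) {p : StrongDual ℝ E} (hp : p ∈ interior (-polarSet X)) :
    dualityInv X f p ∈ interior X :=
  Function.invFunOn_mem ((hf.bijOn_dualityMap h0 hX).surjOn hp)

lemma dualityMap_dualityInv (hf : IsProjSCBarrier X γ f) (h0 : (0 : E) ∈ interior X)
    (hX : Bornology.IsBounded X) {p : StrongDual ℝ E} (hp : p ∈ interior (-polarSet X)) :
    dualityMap f (dualityInv X f p) = p :=
  Function.invFunOn_eq ((hf.bijOn_dualityMap h0 hX).surjOn hp)

lemma one_add_apply_dualityInv_pos (hf : IsProjSCBarrier X γ f) (h0 : (0 : E) ∈ interior X)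
    (hX : Bornology.IsBounded X) {p : StrongDual ℝ E} (hp : p ∈ interior (-polarSet X)) :
    0 < 1 + p (dualityInv X f p) :=
  (mem_interior_neg_polarSet hf.regular.isClosed hX).1 hp _
    (interior_subset (hf.dualityInv_mem h0 hX hp))

lemma critical_dualityInv (hf : IsProjSCBarrier X γ f) (h0 : (0 : E) ∈ interior X)
    (hX : Bornology.IsBounded X) {p : StrongDual ℝ E} (hp : p ∈ interior (-polarSet X)) :
    (1 + p (dualityInv X f p)) • fderiv ℝ f (dualityInv X f p) + p = 0 :=
  (dualityMap_eq_iff (hf.one_add_fderiv_pos h0 (hf.dualityInv_mem h0 hX hp))).1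
    (hf.dualityMap_dualityInv h0 hX hp)

lemma contDiffAt_dualityInv (hf : IsProjSCBarrier X γ f) (h0 : (0 : E) ∈ interior X)
    (hX : Bornology.IsBounded X) {p : StrongDual ℝ E} (hp : p ∈ interior (-polarSet X)) :
    ContDiffAt ℝ 2 (dualityInv X f) p := by
  set x := dualityInv X f p with hxdef
  have hx : x ∈ interior X := hf.dualityInv_mem h0 hX hp
  have hxp : dualityMap f x = p := hf.dualityMap_dualityInv h0 hX hp
  have hc := hf.contDiffAt_dualityMap h0 hx
  have hinj := hf.fderiv_dualityMap_injective h0 hx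
  let L : E ≃L[ℝ] StrongDual ℝ E := (LinearMap.linearEquivOfInjective
    (fderiv ℝ (dualityMap f) x : E →ₗ[ℝ] StrongDual ℝ E) hinj
    (finrank_strongDual E)).toContinuousLinearEquiv
  have hL : HasFDerivAt (dualityMap f) (L : E →L[ℝ] StrongDual ℝ E) x := by
    have h1 : (L : E →L[ℝ] StrongDual ℝ E) = fderiv ℝ (dualityMap f) x := by
      ext; rfl
    rw [h1]
    exact (hc.differentiableAt (by norm_num)).hasFDerivAt
  have hn : (2 : WithTop ℕ∞) ≠ 0 := by norm_num
  have hloc := hc.to_localInverse hL hn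
  have himg := hc.localInverse_apply_image hL hn
  have hright : ∀ᶠ q in 𝓝 (dualityMap f x), dualityMap f (hc.localInverse hL hn q) = q :=
    (hc.hasStrictFDerivAt' hL hn).eventually_right_inverse
  rw [hxp] at hloc himg hright
  refine hloc.congr_of_eventuallyEq ?_
  have hmem : ∀ᶠ q in 𝓝 p, hc.localInverse hL hn q ∈ interior X :=
    hloc.continuousAt.eventually (by rw [himg]; exact isOpen_interior.mem_nhds hx)
  filter_upwards [hmem, hright, isOpen_interior.mem_nhds hp] with q h1 h2 h3
  exact hf.injOn_dualityMap h0 (hf.dualityInv_mem h0 hX h3) h1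
    ((hf.dualityMap_dualityInv h0 hX h3).trans h2.symm)

lemma dualFunction_eq (hf : IsProjSCBarrier X γ f) (h0 : (0 : E) ∈ interior X)
    (hX : Bornology.IsBounded X) {p : StrongDual ℝ E} (hp : p ∈ interior (-polarSet X)) :
    dualFunction X f p = -dualObjective f p (dualityInv X f p) := by
  have h := hf.dualFunction_dualityMap h0 (hf.dualityInv_mem h0 hX hp)
  rwa [hf.dualityMap_dualityInv h0 hX hp] at h

lemma isLeast_dualObjective_dualFunction (hf : IsProjSCBarrier X γ f)
    (h0 : (0 : E) ∈ interior X) (hX : Bornology.IsBounded X) {p : StrongDual ℝ E}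
    (hp : p ∈ interior (-polarSet X)) :
    IsLeast (dualObjective f p '' interior X) (-dualFunction X f p) := by
  have h := hf.isLeast_dualObjective h0 (hf.dualityInv_mem h0 hX hp)
  rw [hf.dualityMap_dualityInv h0 hX hp] at h
  rwa [hf.dualFunction_eq h0 hX hp, neg_neg]

/-- The derivative of the dual function at `p` is `-x / (1 + ⟨x, p⟩)`, where `x` corresponds
to `p` under the duality map. -/
lemma hasFDerivAt_dualFunction (hf : IsProjSCBarrier X γ f) (h0 : (0 : E) ∈ interior X)
    (hX : Bornology.IsBounded X) {p : StrongDual ℝ E} (hp : p ∈ interior (-polarSet X)) :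
    HasFDerivAt (dualFunction X f)
      (-((1 + p (dualityInv X f p))⁻¹ •
        NormedSpace.inclusionInDoubleDual ℝ E (dualityInv X f p))) p := by
  have hpos := hf.one_add_apply_dualityInv_pos h0 hX hp
  have hφ := ((hf.contDiffAt_dualityInv h0 hX hp).differentiableAt (by norm_num)).hasFDerivAt
  have hfd := (hf.contDiffAt (hf.dualityInv_mem h0 hX hp)).hasFDerivAt_fderiv_zero
  have h1 := hfd.comp p hφ
  have h2 := (((hasFDerivAt_id (𝕜 := ℝ) p).clm_apply hφ).const_add 1).log hpos.ne'
  have h3 := (h1.add h2).neg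
  have hev : dualFunction X f =ᶠ[𝓝 p]
      fun q => -(f (dualityInv X f q) + Real.log (1 + q (dualityInv X f q))) := by
    filter_upwards [isOpen_interior.mem_nhds hp] with q hq
    rw [hf.dualFunction_eq h0 hX hq, dualObjective]
  refine (h3.congr_of_eventuallyEq hev).congr_fderiv ?_
  ext k
  have hc := DFunLike.congr_fun (hf.critical_dualityInv h0 hX hp)
    (fderiv ℝ (dualityInv X f) p k)
  simp only [add_apply, smul_apply, smul_eq_mul, zero_apply] at hc
  simp
  field_simp
  linarith

lemma contDiffOn_dualFunction (hf : IsProjSCBarrier X γ f) (h0 : (0 : E) ∈ interior X)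
    (hX : Bornology.IsBounded X) :
    ContDiffOn ℝ 3 (dualFunction X f) (interior (-polarSet X)) := by
  have h3 : (3 : WithTop ℕ∞) = 2 + 1 := by norm_num
  rw [h3, contDiffOn_succ_iff_fderiv_of_isOpen isOpen_interior]
  refine ⟨fun p hp => (hf.hasFDerivAt_dualFunction h0 hX hp).differentiableAt.differentiableWithinAt,
    fun h => absurd h (by decide), fun p hp => ?_⟩
  have hφ := hf.contDiffAt_dualityInv h0 hX hp
  have h1 : ContDiffAt ℝ 2 (fun p : StrongDual ℝ E => 1 + p (dualityInv X f p)) p :=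
    contDiffAt_const.add (contDiffAt_id.clm_apply hφ)
  have h2 := contDiffAt_neg_inv_smul (W := StrongDual ℝ (StrongDual ℝ E)) h1
    (hf.one_add_apply_dualityInv_pos h0 hX hp).ne' hφ (NormedSpace.inclusionInDoubleDual ℝ E)
  refine (h2.congr_of_eventuallyEq ?_).contDiffWithinAt
  filter_upwards [isOpen_interior.mem_nhds hp] with q hq
  exact (hf.hasFDerivAt_dualFunction h0 hX hq).fderiv

/-! ### The metric and the cubic form of the dual function -/

/-- The duality map is an isometry of the affine metrics and changes the sign of the cubic
form. -/
lemma exists_dual_forms_eq (hf : IsProjSCBarrier X γ f) (h0 : (0 : E) ∈ interior X)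
    (hX : Bornology.IsBounded X) {p : StrongDual ℝ E} (hp : p ∈ interior (-polarSet X))
    (k : StrongDual ℝ E) :
    ∃ h : E, (h = 0 → k = 0) ∧
      affineMetric (dualFunction X f) p k = affineMetric f (dualityInv X f p) h ∧
      cubicForm (dualFunction X f) p k = -cubicForm f (dualityInv X f p) h := by
  set ev := NormedSpace.inclusionInDoubleDual ℝ E with hev
  set φ := dualityInv X f with hφdef
  have hp0 : p + (0 : ℝ) • k = p := by simp
  have hline := hasDerivAt_line p k
  have hmem : ∀ᶠ t in 𝓝 (0 : ℝ), p + t • k ∈ interior (-polarSet X) :=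
    (tendsto_line p k).eventually (isOpen_interior.mem_nhds hp)
  have hx : ∀ᶠ t in 𝓝 (0 : ℝ), HasDerivAt (fun t : ℝ => φ (p + t • k))
      (fderiv ℝ φ (p + t • k) k) t := by
    filter_upwards [hmem] with t ht
    exact hasDerivAt_comp_of_hasFDerivAt
      ((hf.contDiffAt_dualityInv h0 hX ht).differentiableAt (by norm_num)).hasFDerivAt (hline t)
  obtain ⟨x₂, hx₂⟩ : ∃ x₂, HasDerivAt (fun t : ℝ => fderiv ℝ φ (p + t • k) k) x₂ 0 := by
    have h1 : DifferentiableAt ℝ (fderiv ℝ φ) p :=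
      ((hf.contDiffAt_dualityInv h0 hX hp).fderiv_right (m := 1) (by norm_num)).differentiableAt
        (by norm_num)
    have h2 : HasDerivAt (fun t : ℝ => fderiv ℝ φ (p + t • k)) (fderiv ℝ (fderiv ℝ φ) p k) 0 :=
      hasDerivAt_comp_of_hasFDerivAt (W := StrongDual ℝ E →L[ℝ] E)
        (by rw [hp0]; exact h1.hasFDerivAt) (hline 0)
    exact ⟨_, h2.clm_apply (hasDerivAt_const 0 k)⟩
  have hconst : HasDerivAt (fun _ : ℝ => k) 0 0 := hasDerivAt_const 0 k
  have hlines : ∀ᶠ t in 𝓝 (0 : ℝ), HasDerivAt (fun t : ℝ => p + t • k) k t :=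
    Eventually.of_forall hline
  have hevx : ∀ᶠ t in 𝓝 (0 : ℝ), HasDerivAt (fun t : ℝ => ev (φ (p + t • k)))
      (ev (fderiv ℝ φ (p + t • k) k)) t := by
    filter_upwards [hx] with t ht
    exact hasDerivAt_comp_of_hasFDerivAt (W := StrongDual ℝ (StrongDual ℝ E)) ev.hasFDerivAt ht
  have hevx₂ : HasDerivAt (fun t : ℝ => ev (fderiv ℝ φ (p + t • k) k)) (ev x₂) 0 :=
    hasDerivAt_comp_of_hasFDerivAt (W := StrongDual ℝ (StrongDual ℝ E)) ev.hasFDerivAt hx₂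
  have heq : ∀ᶠ t in 𝓝 (0 : ℝ), (1 + (p + t • k) (φ (p + t • k))) •
      fderiv ℝ f (φ (p + t • k)) + (p + t • k) = 0 := by
    filter_upwards [hmem] with t ht using hf.critical_dualityInv h0 hX ht
  have heq' : ∀ᶠ t in 𝓝 (0 : ℝ), (1 + ev (φ (p + t • k)) (p + t • k)) •
      fderiv ℝ (dualFunction X f) (p + t • k) + ev (φ (p + t • k)) = 0 := by
    filter_upwards [hmem] with t ht
    have hpos := hf.one_add_apply_dualityInv_pos h0 hX ht
    rw [(hf.hasFDerivAt_dualFunction h0 hX ht).fderiv, NormedSpace.dual_def]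
    exact smul_neg_inv_smul_add_self (W := StrongDual ℝ (StrongDual ℝ E)) hpos.ne' _
  have hF : ContDiffAt ℝ 3 f (φ (p + (0 : ℝ) • k)) := by
    rw [hp0]; exact hf.contDiffAt (hf.dualityInv_mem h0 hX hp)
  have hF' : ContDiffAt ℝ 3 (dualFunction X f) (p + (0 : ℝ) • k) := by
    rw [hp0]; exact (hf.contDiffOn_dualFunction h0 hX).contDiffAt (isOpen_interior.mem_nhds hp)
  have hD : 1 + (p + (0 : ℝ) • k) (φ (p + (0 : ℝ) • k)) ≠ 0 := by
    rw [hp0]; exact (hf.one_add_apply_dualityInv_pos h0 hX hp).ne'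
  have a1 := fderiv_fderiv_curve hF hx.self_of_nhds (hline 0) heq
  have m1 := affineMetric_curve hF hx.self_of_nhds (hline 0) heq hD
  have m2 := affineMetric_curve hF' (hline 0) hevx.self_of_nhds heq' hD
  have c1 := cubicForm_curve hF hx hx₂ hlines hconst heq hD
  have c2 := cubicForm_curve hF' hlines hconst hevx hevx₂ heq' hD
  simp only [hp0, NormedSpace.dual_def, hev, map_zero, zero_apply] at a1 m1 m2 c1 c2
  refine ⟨fderiv ℝ φ p k, fun h => ?_, ?_, ?_⟩
  · rw [h, map_zero, map_zero, smul_zero, zero_add, add_zero] at a1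
    have h1 := DFunLike.congr_fun a1 (φ p)
    simp only [add_apply, smul_apply, smul_eq_mul, zero_apply] at h1
    have h2 := hf.one_add_fderiv_pos h0 (hf.dualityInv_mem h0 hX hp)
    have h3 : k (φ p) = 0 := by
      have : k (φ p) * (1 + fderiv ℝ f (φ p) (φ p)) = 0 := by linarith
      exact (mul_eq_zero.1 this).resolve_right h2.ne'
    rwa [h3, zero_smul, zero_add] at a1
  · rw [m1, m2]
    ring
  · rw [c1, c2]
    ring

lemma tendsto_dualFunction (hf : IsProjSCBarrier X γ f) (h0 : (0 : E) ∈ interior X)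
    (hX : Bornology.IsBounded X) {p : StrongDual ℝ E} (hp : p ∈ frontier (-polarSet X)) :
    Tendsto (dualFunction X f) (𝓝[interior (-polarSet X)] p) atTop := by
  have hpm : p ∈ -polarSet X := isClosed_neg_polarSet.frontier_subset hp
  have hpi : p ∉ interior (-polarSet X) := hp.2
  rw [mem_interior_neg_polarSet hf.regular.isClosed hX] at hpi
  push Not at hpi
  obtain ⟨y, hy, hpy⟩ := hpi
  rw [tendsto_atTop]
  intro B
  obtain ⟨x, hx, hpx, hlt⟩ := hf.exists_dualObjective_lt h0 hy
    (le_antisymm hpy (mem_neg_polarSet.1 hpm y hy)) (-B)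
  have hcont : ContinuousAt (fun q : StrongDual ℝ E => dualObjective f q x) p := by
    have h1 : ContinuousAt (fun q : StrongDual ℝ E => 1 + q x) p := by fun_prop
    exact continuousAt_const.add (h1.log hpx.ne')
  have hev := hcont.eventually (gt_mem_nhds hlt)
  filter_upwards [hev.filter_mono nhdsWithin_le_nhds, self_mem_nhdsWithin] with q hq1 hq2
  have := (hf.isLeast_dualObjective_dualFunction h0 hX hq2).2 (Set.mem_image_of_mem _ hx)
  linarith

lemma dual (hf : IsProjSCBarrier X γ f) (hX : Bornology.IsBounded X)
    (hXpolar : Bornology.IsBounded (polarSet X)) :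
    IsProjSCBarrier (-polarSet X) γ (dualFunction X f) := by
  have h0 := hf.regular.zero_mem_interior hXpolar
  refine ⟨isRegularConvexSet_neg_polarSet hf.regular.isClosed hX hXpolar, hf.parameter_nonneg,
    hf.contDiffOn_dualFunction h0 hX, fun p hp k hk => ?_,
    fun p hp => hf.tendsto_dualFunction h0 hX hp, fun p hp k => ?_⟩
  · obtain ⟨h, hh, hm, -⟩ := hf.exists_dual_forms_eq h0 hX hp k
    rw [hm]
    exact hf.affineMetric_pos _ (hf.dualityInv_mem h0 hX hp) h fun e => hk (hh e)
  · obtain ⟨h, -, hm, hc⟩ := hf.exists_dual_forms_eq h0 hX hp k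
    rw [hm, hc, abs_neg]
    exact hf.cubicForm_le _ (hf.dualityInv_mem h0 hX hp) h

end IsProjSCBarrier

end ProjSC

theorem mainTheorem7 {E : Type*} [NormedAddCommGroup E] [NormedSpace ℝ E]
    [FiniteDimensional ℝ E] (X : Set E) (f : E → ℝ) (γ : ℝ)
    (hf : ProjSC.IsProjSCBarrier X γ f)
    (hX : Bornology.IsBounded X) (hXpolar : Bornology.IsBounded (ProjSC.polarSet X)) :
    -- the dual function is defined exactly on the interior of `-X°`
    ProjSC.dualDomain X f = interior (-ProjSC.polarSet X) ∧
    -- there the minimum is attained, and the dual function is minus its value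
    (∀ p ∈ interior (-ProjSC.polarSet X),
      IsLeast (ProjSC.dualObjective f p '' interior X) (-ProjSC.dualFunction X f p)) ∧
    -- the dual function is a barrier on `-X°` with the same parameter
    ProjSC.IsProjSCBarrier (-ProjSC.polarSet X) γ (ProjSC.dualFunction X f) ∧
    -- the denominator of the duality map is positive on the interior of `X`
    (∀ x ∈ interior X, 0 < 1 + fderiv ℝ f x x) ∧
    -- the duality map is a bijection between the interiors of `X` and `-X°`
    Set.BijOn (ProjSC.dualityMap f) (interior X) (interior (-ProjSC.polarSet X)) := by
  have h0 := hf.regular.zero_mem_interior hXpolar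
  exact ⟨hf.dualDomain_eq h0 hX, fun p hp => hf.isLeast_dualObjective_dualFunction h0 hX hp,
    hf.dual hX hXpolar, fun x hx => hf.one_add_fderiv_pos h0 hx, hf.bijOn_dualityMap h0 hX⟩
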